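/- Let $\mathcal H$ be a separable complex Hilbert space, and let $\varphi_T:B(\mathcal H)\to B(\mathcal H)$ be a $w^*$-continuous completely positive linear map with $\varphi_T(I)\le I$, given by a finite or countably infinite family $T=(T_i)_i$ of operators in $B(\mathcal H)$, that is, $\varphi_T(X)=\sum_i T_iXT_i^*$ for all $X\in B(\mathcal H)$, where the sum converges in the $w^*$-topology. Let $V=(V_i)_i$ be the minimal isometric dilation of $T$ on a Hilbert space $\mathcal K\supseteq\mathcal H$: the $V_i\in B(\mathcal K)$ are isometries with pairwise orthogonal ranges, $V_i^*|_{\mathcal H}=T_i^*$ for all $i$, and $\mathcal K$ is the closed linear span of the vectors $V_{i_1}\cdots V_{i_k}h$ with $k\ge 0$ and $h\in\mathcal H$. Let $\varphi_V(Y)=\sum_i V_iYV_i^*$ for $Y\in B(\mathcal K)$, where the sum again converges in the $w^*$-topology, and let $P_{\mathcal H}$ be the orthogonal projection of $\mathcal K$ onto $\mathcal H$. For a positive linear map $\varphi$ on $B(\mathcal H)$ (or on $B(\mathcal K)$), a pure solution of $\varphi(X)\le X$ is an operator $C$ with $\varphi(C)\le C$ and $\varphi^k(C)\to 0$ in the strong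 operator topology as $k\to\infty$. (i) A positive operator $C\in B(\mathcal H)$ satisfies $\varphi_T(C)\le C$ (resp. $\varphi_T(C)=C$) if and only if $C=P_{\mathcal H}D|_{\mathcal H}$ for some positive operator $D\in B(\mathcal K)$ such that $\varphi_V(D)\le D$ (resp. $\varphi_V(D)=D$) and $\|D\|=\|C\|$. (ii) An operator $C\in B(\mathcal H)$ is a pure solution of $\varphi_T(X)\le X$ if and only if $C=P_{\mathcal H}D|_{\mathcal H}$ for some pure solution $D\in B(\mathcal K)$ of $\varphi_V(Y)\le Y$ with $\|D\|=\|C\|$. -/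

import Mathlib

open Filter Topology
open scoped InnerProductSpace CStarAlgebra InnerProduct

/-- The `w*`-topology (ultraweak topology) on `B(H)`: the coarsest topology for which every
functional `A ↦ ∑ₖ ⟪xₖ, A yₖ⟫`, with `∑ₖ ‖xₖ‖² < ∞` and `∑ₖ ‖yₖ‖² < ∞`, is continuous.
(These functionals are exactly the elements of the predual of `B(H)`, and each of these series
converges absolutely.) -/
noncomputable abbrev weakStarTopology (H : Type*) [NormedAddCommGroup H] [InnerProductSpace ℂ H] :
    TopologicalSpace (H →L[ℂ] H) :=
  ⨅ (x : lp (fun _ : ℕ => H) 2) (y : lp (fun _ : ℕ => H) 2),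
    TopologicalSpace.induced (fun A : H →L[ℂ] H => ∑' k : ℕ, ⟪x k, A (y k)⟫_ℂ) inferInstance

/-- Continuity of a map `B(H) → B(H)` for the `w*`-topology on both sides. -/
def IsWeakStarContinuous {H : Type*} [NormedAddCommGroup H] [InnerProductSpace ℂ H]
    (φ : (H →L[ℂ] H) → (H →L[ℂ] H)) : Prop :=
  @Continuous _ _ (weakStarTopology H) (weakStarTopology H) φ

/-- `φ` is the map `φ_A` determined by the family `A`, that is `φ(X) = ∑ᵢ Aᵢ X Aᵢ*` for every
`X ∈ B(H)`, where the sum is the limit of the finite partial sums in the `w*`-topology. -/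
def IsDeterminedBy {H ι : Type*} [NormedAddCommGroup H] [InnerProductSpace ℂ H]
    [CompleteSpace H] (φ : (H →L[ℂ] H) → (H →L[ℂ] H)) (A : ι → (H →L[ℂ] H)) : Prop :=
  ∀ X : H →L[ℂ] H,
    Tendsto (fun s : Finset ι => ∑ i ∈ s, A i ∘L X ∘L (A i)†) atTop
      (@nhds (H →L[ℂ] H) (weakStarTopology H) (φ X))

/-- `C` is a pure solution of `φ(X) ≤ X`: it is a solution (for the Loewner order) and
`φᵏ(C) → 0` in the strong operator topology. -/
def IsPureSolution {H : Type*} [NormedAddCommGroup H] [InnerProductSpace ℂ H]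
    [CompleteSpace H] (φ : (H →L[ℂ] H) → (H →L[ℂ] H)) (C : H →L[ℂ] H) : Prop :=
  φ C ≤ C ∧ ∀ h : H, Tendsto (fun k : ℕ => (φ^[k] C) h) atTop (𝓝 0)

/-- The family `V` on `K` is the minimal isometric dilation of the row `T` on `H`, where `H` is
regarded as a subspace of `K` through the isometric embedding `J`: the `Vᵢ` are isometries with
pairwise orthogonal ranges, `Vᵢ*|_H = Tᵢ*`, and `K` is the closed linear span of the vectors
`V_α h`, where `h ∈ H` and `V_α` is the product of the `Vᵢ` along a finite word `α`. -/
structure IsMinimalIsometricDilation {H K ι : Type*}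
    [NormedAddCommGroup H] [InnerProductSpace ℂ H] [CompleteSpace H]
    [NormedAddCommGroup K] [InnerProductSpace ℂ K] [CompleteSpace K]
    (T : ι → (H →L[ℂ] H)) (J : H →ₗᵢ[ℂ] K) (V : ι → (K →L[ℂ] K)) : Prop where
  norm_map : ∀ i x, ‖V i x‖ = ‖x‖
  orthogonal_ranges : ∀ i j, i ≠ j → ∀ x y, ⟪V i x, V j y⟫_ℂ = 0
  adjoint_map : ∀ i h, ((V i)†) (J h) = J (((T i)†) h)
  minimal : (Submodule.span ℂ
    {y : K | ∃ (α : List ι) (h : H), y = (α.map V).prod (J h)}).topologicalClosure = ⊤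

/-- The compression `P_H D|_H ∈ B(H)` of `D ∈ B(K)`, where `H` is regarded as a subspace of `K`
through the isometric embedding `J`. -/
noncomputable def compression {H K : Type*}
    [NormedAddCommGroup H] [InnerProductSpace ℂ H] [CompleteSpace H]
    [NormedAddCommGroup K] [InnerProductSpace ℂ K] [CompleteSpace K]
    (J : H →ₗᵢ[ℂ] K) (D : K →L[ℂ] K) : H →L[ℂ] H :=
  (J.toContinuousLinearMap)† ∘L D ∘L J.toContinuousLinearMap

/-! A dilation `D` of `C` with `0 ≤ D ≤ ‖C‖` has the same norm as `C`. These dilations form a convex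
set `S`, compact in the weak operator topology and nonempty by Douglas' factorization lemma. If
`φ_T(C) ≤ C` and `D ∈ S`, then `φ_V(D)` compresses to `φ_T(C) ≤ C`, and Douglas' lemma, applied
between `φ_V(D)` and `‖C‖`, gives some `f D ∈ S` with `φ_V(D) ≤ f D`. A weak limit point `L` of the
Cesàro averages of `D, f D, f² D, …` is also one of the averages of `f D, f² D, …`, which dominate
the images under `φ_V` of the former. As `φ_V` is only lower semicontinuous on positive operators
(Fatou's lemma), this yields `φ_V(L) ≤ L`. If `φ_T(C) = C`, then `f = φ_V` is allowed, and Fatou's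
lemma for `‖C‖ - D` gives the opposite inequality.

If `C` is pure and `D` is a solution dilating it, then `φ_V^k(D) J h → 0` by the Cauchy–Schwarz
inequality for the form `⟪x, φ_V^k(D) y⟫`, and `φ_V(D) V_j = V_j D` carries this over to the vectors
`V_α J h`, which span a dense subspace. -/

open scoped ComplexOrder

section WeakOperatorTopology

open ContinuousLinearMapWOT InnerProductSpace

variable {𝕜 E F : Type*} [RCLike 𝕜] [NormedAddCommGroup E] [InnerProductSpace 𝕜 E]
  [NormedAddCommGroup F] [InnerProductSpace 𝕜 F] [CompleteSpace F]

theorem exists_continuousLinearMap_of_bounded_sesquilinear (B : E →ₗ⋆[𝕜] F →ₗ[𝕜] 𝕜) {N : ℝ}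
    (hN : 0 ≤ N) (hB : ∀ x y, ‖B x y‖ ≤ N * ‖x‖ * ‖y‖) :
    ∃ L : E →L[𝕜] F, ‖L‖ ≤ N ∧ ∀ x y, ⟪L x, y⟫_𝕜 = B x y := by
  let L : E →L[𝕜] F :=
    ((toDual 𝕜 F).symm : StrongDual 𝕜 F →L⋆[𝕜] F).comp (B.mkContinuous₂ N hB)
  refine ⟨L, L.opNorm_le_bound hN fun x => ?_, fun x y => toDual_symm_apply⟩
  calc ‖L x‖ = ‖B.mkContinuous₂ N hB x‖ := (toDual 𝕜 F).symm.norm_map _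
    _ ≤ N * ‖x‖ := ContinuousLinearMap.le_of_opNorm_le _ (B.mkContinuous₂_norm_le hN hB) x

theorem exists_opNorm_le_of_tendsto_inner {α : Type*} {f : Filter α} [f.NeBot]
    {A : α → E →L[𝕜] F} {N : ℝ} (hN : 0 ≤ N) {l : E → F → 𝕜}
    (hl : ∀ x y, ‖l x y‖ ≤ N * ‖x‖ * ‖y‖)
    (hlim : ∀ x y, Tendsto (fun a => ⟪A a x, y⟫_𝕜) f (𝓝 (l x y))) :
    ∃ L : E →L[𝕜] F, ‖L‖ ≤ N ∧ ∀ x y, ⟪L x, y⟫_𝕜 = l x y :=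
  exists_continuousLinearMap_of_bounded_sesquilinear (LinearMap.mk₂'ₛₗ _ _ l
    (fun x x' y => tendsto_nhds_unique (hlim _ _)
      (((hlim x y).add (hlim x' y)).congr fun a => by rw [map_add, inner_add_left]))
    (fun c x y => tendsto_nhds_unique (hlim _ _)
      (((hlim x y).const_mul (star c)).congr fun a => by rw [map_smul, inner_smul_left]; rfl))
    (fun x y y' => tendsto_nhds_unique (hlim _ _)
      (((hlim x y).add (hlim x y')).congr fun a => by rw [inner_add_right]))
    (fun c x y => tendsto_nhds_unique (hlim _ _)
      (((hlim x y).const_mul c).congr fun a => by rw [inner_smul_right]))) hN hl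

theorem isCompact_setOf_opNorm_le (N : ℝ) : IsCompact {A : E →WOT[𝕜] F | ‖A.toCLM‖ ≤ N} := by
  rw [isCompact_iff_ultrafilter_le_nhds]
  intro U hU
  rw [le_principal_iff] at hU
  have hN : 0 ≤ N := by
    obtain ⟨A, hA⟩ := U.nonempty_of_mem hU
    exact (norm_nonneg _).trans hA
  have hscalar (x : E) (y : F) : ∃ l : 𝕜, ‖l‖ ≤ N * ‖x‖ * ‖y‖ ∧
      Tendsto (fun A : E →WOT[𝕜] F => ⟪A.toCLM x, y⟫_𝕜) U (𝓝 l) := by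
    obtain ⟨l, hl, hlim⟩ := (isCompact_closedBall (0 : 𝕜) (N * ‖x‖ * ‖y‖)).ultrafilter_le_nhds
      (U.map fun A : E →WOT[𝕜] F => ⟪A.toCLM x, y⟫_𝕜) (by
        rw [le_principal_iff]
        refine Filter.mem_map.2 (mem_of_superset hU fun A hA => ?_)
        refine mem_closedBall_zero_iff.2 ((norm_inner_le_norm _ _).trans ?_)
        gcongr
        exact A.toCLM.le_of_opNorm_le hA x)
    exact ⟨l, mem_closedBall_zero_iff.1 hl, hlim⟩
  choose l hl hlim using hscalar
  obtain ⟨L, hLN, hL⟩ := exists_opNorm_le_of_tendsto_inner hN hl hlim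
  refine ⟨.ofCLM L, hLN, le_nhds_iff_forall_inner_apply_le_nhds.2 fun x y => ?_⟩
  simp_rw [← inner_conj_symm y]
  refine (RCLike.continuous_conj.tendsto _).comp ?_
  rw [ofCLM_apply, hL]
  exact hlim x y

end WeakOperatorTopology

section LoewnerOrder

variable {E F G : Type*} [NormedAddCommGroup E] [InnerProductSpace ℂ E]
  [NormedAddCommGroup F] [InnerProductSpace ℂ F] [CompleteSpace F]
  [NormedAddCommGroup G] [InnerProductSpace ℂ G] [CompleteSpace G]

theorem loewner_le_iff {X Y : E →L[ℂ] E} :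
    X ≤ Y ↔ ∀ x, ⟪x, X x⟫_ℂ ≤ ⟪x, Y x⟫_ℂ := by
  constructor
  · intro h x
    have := (ContinuousLinearMap.le_def _ _).1 h |>.inner_nonneg_right x
    simpa [inner_sub_right] using this
  · intro h
    rw [ContinuousLinearMap.le_def, ContinuousLinearMap.isPositive_iff_complex]
    intro x
    have h0 : 0 ≤ ⟪x, (Y - X) x⟫_ℂ := by
      simpa [inner_sub_right] using h x
    have h1 : 0 ≤ ⟪(Y - X) x, x⟫_ℂ := by
      rw [← inner_conj_symm]
      exact star_nonneg_iff.2 h0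
    obtain ⟨h2, h3⟩ := Complex.le_def.1 h1
    exact ⟨Complex.ext rfl h3, h2⟩

theorem loewner_nonneg_iff {X : E →L[ℂ] E} : 0 ≤ X ↔ ∀ x, 0 ≤ ⟪x, X x⟫_ℂ := by
  simp only [loewner_le_iff, zero_apply, inner_zero_right]

theorem isClosed_setOf_toCLM_mem_Icc (X Y : F →L[ℂ] F) :
    IsClosed {A : F →WOT[ℂ] F | A.toCLM ∈ Set.Icc X Y} := by
  simp only [Set.mem_Icc, loewner_le_iff, ContinuousLinearMapWOT.toCLM_apply]
  refine .inter (?_ : IsClosed {A : F →WOT[ℂ] F | ∀ x, _}) (?_ : IsClosed {A | ∀ x, _})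
  all_goals
    simp only [Set.ofPred_forall]
    exact isClosed_iInter fun x => isClosed_le (by fun_prop) (by fun_prop)

/-- Douglas' factorization lemma. -/
theorem exists_contraction_comp_eq {A : E →L[ℂ] F} {B : E →L[ℂ] G}
    (h : ∀ x, ‖A x‖ ≤ ‖B x‖) :
    ∃ Z : G →L[ℂ] F, (∀ y, ‖Z y‖ ≤ ‖y‖) ∧ Z ∘L B = A := by
  let M : Submodule ℂ G := (LinearMap.range B.toLinearMap).topologicalClosure
  let P : G →L[ℂ] M := M.orthogonalProjectionOnto
  let e : E →ₗ[ℂ] M := B.toLinearMap.codRestrict M fun x =>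
    Submodule.le_topologicalClosure _ (LinearMap.mem_range_self _ x)
  have he : DenseRange e := fun y => by
    rw [closure_subtype]
    refine closure_mono ?_ y.2
    rintro _ ⟨x, rfl⟩
    exact ⟨e x, ⟨x, rfl⟩, rfl⟩
  have hn (x : E) : ‖A.toLinearMap x‖ ≤ 1 * ‖e x‖ := (h x).trans_eq (one_mul _).symm
  refine ⟨(A.toLinearMap.extendOfNorm e).comp P, fun y => ?_, ?_⟩
  · calc _ ≤ 1 * ‖P y‖ := A.toLinearMap.norm_extendOfNorm_apply_le he 1 hn _
      _ ≤ ‖y‖ := by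
        rw [one_mul]
        exact M.norm_orthogonalProjectionOnto_apply_le y
  · ext x
    have hP : P (B x) = e x := M.orthogonalProjectionOnto_mem_subspace_eq_self (e x)
    rw [ContinuousLinearMap.comp_apply, ContinuousLinearMap.comp_apply, hP]
    exact A.toLinearMap.extendOfNorm_eq he ⟨1, hn⟩ x

theorem inner_adjoint_comp_self (A : F →L[ℂ] G) (x : F) :
    ⟪x, (A† ∘L A) x⟫_ℂ = ((‖A x‖ ^ 2 : ℝ) : ℂ) := by
  rw [ContinuousLinearMap.comp_apply, ContinuousLinearMap.adjoint_inner_right,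
    inner_self_eq_norm_sq_to_K]
  exact (Complex.ofReal_pow _ _).symm

theorem adjoint_comp_self_le_iff {A : F →L[ℂ] E} {B : F →L[ℂ] G} [CompleteSpace E] :
    A† ∘L A ≤ B† ∘L B ↔ ∀ x, ‖A x‖ ≤ ‖B x‖ := by
  simp only [loewner_le_iff, inner_adjoint_comp_self, Complex.real_le_real,
    sq_le_sq₀ (norm_nonneg _) (norm_nonneg _)]

theorem exists_adjoint_comp_self_eq {X : F →L[ℂ] F} (hX : 0 ≤ X) :
    ∃ A : F →L[ℂ] F, A† ∘L A = X := by
  obtain ⟨A, rfl⟩ := CStarAlgebra.nonneg_iff_eq_star_mul_self.1 hX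
  exact ⟨A, rfl⟩

theorem exists_mem_Icc_compression_eq_of_nonneg {R : G →L[ℂ] G} {C : F →L[ℂ] F} (J : F →L[ℂ] G)
    (hR : 0 ≤ R) (hC : 0 ≤ C) (hCR : C ≤ J† ∘L R ∘L J) :
    ∃ D ∈ Set.Icc 0 R, J† ∘L D ∘L J = C := by
  obtain ⟨A, rfl⟩ := exists_adjoint_comp_self_eq hR
  obtain ⟨B, rfl⟩ := exists_adjoint_comp_self_eq hC
  have hBA : B† ∘L B ≤ (A ∘L J)† ∘L (A ∘L J) := by
    rwa [ContinuousLinearMap.adjoint_comp]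
  obtain ⟨Z, hZ, rfl⟩ := exists_contraction_comp_eq (adjoint_comp_self_le_iff.1 hBA)
  refine ⟨(Z ∘L A)† ∘L (Z ∘L A), ⟨?_, adjoint_comp_self_le_iff.2 fun x => hZ (A x)⟩, ?_⟩
  · exact (ContinuousLinearMap.nonneg_iff_isPositive _).2
      (ContinuousLinearMap.isPositive_adjoint_comp_self _)
  · simp only [ContinuousLinearMap.adjoint_comp]
    rfl

theorem exists_mem_Icc_compression_eq {B R : G →L[ℂ] G} {C : F →L[ℂ] F} (J : F →L[ℂ] G)
    (hBR : B ≤ R) (hBC : J† ∘L B ∘L J ≤ C) (hCR : C ≤ J† ∘L R ∘L J) :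
    ∃ D ∈ Set.Icc B R, J† ∘L D ∘L J = C := by
  obtain ⟨D, ⟨hD, hDR⟩, hDC⟩ := exists_mem_Icc_compression_eq_of_nonneg J (sub_nonneg.2 hBR)
    (sub_nonneg.2 hBC) (by simpa using hCR)
  refine ⟨B + D, ⟨le_add_of_nonneg_right hD, add_comm B D ▸ le_sub_iff_add_le.1 hDR⟩, ?_⟩
  simp only [ContinuousLinearMap.add_comp, ContinuousLinearMap.comp_add, hDC, add_sub_cancel]

theorem norm_apply_sq_le_of_nonneg {X : F →L[ℂ] F} (hX : 0 ≤ X) (x : F) :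
    ‖X x‖ ^ 2 ≤ ‖X‖ * ‖⟪x, X x⟫_ℂ‖ := by
  obtain ⟨A, rfl⟩ := exists_adjoint_comp_self_eq hX
  have hA : ‖(A†) (A x)‖ ≤ ‖A‖ * ‖A x‖ := by
    simpa only [LinearIsometryEquiv.norm_map] using (A†).le_opNorm (A x)
  calc ‖(A†) (A x)‖ ^ 2 ≤ (‖A‖ * ‖A x‖) ^ 2 := by gcongr
    _ = ‖A† ∘L A‖ * ‖⟪x, (A† ∘L A) x⟫_ℂ‖ := by
      rw [inner_adjoint_comp_self, ContinuousLinearMap.norm_adjoint_comp_self,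
        Complex.norm_of_nonneg (sq_nonneg _)]
      ring

end LoewnerOrder

section BirkhoffAverage

theorem eventually_birkhoffAverage_mem {E : Type*} [AddCommGroup E] [Module ℝ E] {S : Set E}
    (hS : Convex ℝ S) {F : E → E} (hF : Set.MapsTo F S S) {x : E} (hx : x ∈ S) :
    ∀ᶠ n in atTop, birkhoffAverage ℝ F id n x ∈ S := by
  filter_upwards [eventually_ne_atTop 0] with n hn
  rw [birkhoffAverage, birkhoffSum, Finset.smul_sum]
  exact hS.sum_mem (fun _ _ => by positivity) (by simp [hn]) fun k _ => hF.iterate k hx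

theorem exists_mem_tendsto_birkhoffAverage {E F : Type*}
    [NormedAddCommGroup E] [InnerProductSpace ℂ E]
    [NormedAddCommGroup F] [InnerProductSpace ℂ F] [CompleteSpace F]
    {S : Set (E →L[ℂ] F)} (hS : Convex ℝ S)
    (hclosed : IsClosed {A : E →WOT[ℂ] F | A.toCLM ∈ S}) {N : ℝ} (hN : ∀ X ∈ S, ‖X‖ ≤ N)
    {f : (E →L[ℂ] F) → (E →L[ℂ] F)} (hf : Set.MapsTo f S S) {X : E →L[ℂ] F} (hX : X ∈ S) :
    ∃ L ∈ S,
      Tendsto (fun n => ContinuousLinearMapWOT.ofCLM (birkhoffAverage ℝ f id n X))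
        (hyperfilter ℕ) (𝓝 (.ofCLM L)) ∧
      Tendsto (fun n => ContinuousLinearMapWOT.ofCLM (birkhoffAverage ℝ f id n (f X)))
        (hyperfilter ℕ) (𝓝 (.ofCLM L)) := by
  have hmem := (eventually_birkhoffAverage_mem hS hf hX).filter_mono Nat.hyperfilter_le_atTop
  obtain ⟨⟨L⟩, -, hL⟩ := (isCompact_setOf_opNorm_le N).ultrafilter_le_nhds
    ((hyperfilter ℕ).map fun n => .ofCLM (birkhoffAverage ℝ f id n X))
    (le_principal_iff.2 (hmem.mono fun _ => hN _))
  refine ⟨L, hclosed.mem_of_tendsto hL hmem, hL, ?_⟩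
  have hbdd : Bornology.IsBounded (Set.range fun k => id (f^[k] X)) :=
    (isBounded_iff_forall_norm_le.2 ⟨N, hN⟩).subset
      (Set.range_subset_iff.2 fun k => hf.iterate k hX)
  have hshift := (ContinuousLinearMapWOT.continuous_ofCLM.tendsto 0).comp
    ((tendsto_birkhoffAverage_apply_sub_birkhoffAverage ℝ hbdd).mono_left
      Nat.hyperfilter_le_atTop)
  simpa [Function.comp_def] using hshift.add hL

end BirkhoffAverage

namespace IsDeterminedBy

variable {E ι : Type*} [NormedAddCommGroup E] [InnerProductSpace ℂ E] [CompleteSpace E]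
  {φ : (E →L[ℂ] E) → (E →L[ℂ] E)} {A : ι → (E →L[ℂ] E)}

theorem hasSum (h : IsDeterminedBy φ A) (X : E →L[ℂ] E) (x y : E) :
    HasSum (fun i => ⟪((A i)†) x, X (((A i)†) y)⟫_ℂ) ⟪x, φ X y⟫_ℂ := by
  let u : lp (fun _ : ℕ => E) 2 := lp.single 2 0 x
  let v : lp (fun _ : ℕ => E) 2 := lp.single 2 0 y
  have hf (B : E →L[ℂ] E) : ∑' k : ℕ, ⟪u k, B (v k)⟫_ℂ = ⟪x, B y⟫_ℂ := by
    rw [tsum_eq_single 0 fun k hk => by simp [u, v, hk]]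
    simp [u, v]
  have hc : @Continuous _ _ (weakStarTopology E) _ (fun B : E →L[ℂ] E => ⟪x, B y⟫_ℂ) := by
    simp_rw [← hf]
    exact continuous_iff_le_induced.2 ((iInf_le _ u).trans (iInf_le _ v))
  refine ((@Continuous.tendsto _ _ (weakStarTopology E) _ _ hc (φ X)).comp (h X)).congr fun s => ?_
  simp [Function.comp_apply, sum_apply, ContinuousLinearMap.adjoint_inner_left]

theorem monotone (h : IsDeterminedBy φ A) : Monotone φ := fun X Y hXY =>
  loewner_le_iff.2 fun x =>
    hasSum_le (fun i => loewner_le_iff.1 hXY (((A i)†) x)) (h.hasSum X x x) (h.hasSum Y x x)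

theorem map_nonneg (h : IsDeterminedBy φ A) {X : E →L[ℂ] E} (hX : 0 ≤ X) : 0 ≤ φ X :=
  loewner_nonneg_iff.2 fun x => (h.hasSum X x x).nonneg fun _ => loewner_nonneg_iff.1 hX _

theorem iterate_nonneg (h : IsDeterminedBy φ A) {X : E →L[ℂ] E} (hX : 0 ≤ X) (k : ℕ) :
    0 ≤ φ^[k] X :=
  have hmaps : Set.MapsTo φ (Set.Ici 0) (Set.Ici 0) := fun _ => h.map_nonneg
  hmaps.iterate k hX

/-- Fatou's lemma for the series `∑ᵢ ⟪Aᵢ* x, X Aᵢ* x⟫`: the map `φ` need not be continuous for the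
weak operator topology, but is lower semicontinuous on positive operators. -/
theorem map_le_of_tendsto (h : IsDeterminedBy φ A) {α : Type*} {f : Filter α} [f.NeBot]
    {X Y : α → E →L[ℂ] E} {X₀ Y₀ : E →L[ℂ] E} (hX₀ : ∀ᶠ a in f, 0 ≤ X a)
    (hle : ∀ᶠ a in f, φ (X a) ≤ Y a)
    (hX : Tendsto (fun a => ContinuousLinearMapWOT.ofCLM (X a)) f (𝓝 (.ofCLM X₀)))
    (hY : Tendsto (fun a => ContinuousLinearMapWOT.ofCLM (Y a)) f (𝓝 (.ofCLM Y₀))) :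
    φ X₀ ≤ Y₀ := by
  rw [ContinuousLinearMapWOT.tendsto_iff_forall_inner_apply_tendsto] at hX hY
  refine loewner_le_iff.2 fun x => hasSum_le_of_sum_le (h.hasSum X₀ x x) fun s => ?_
  refine le_of_tendsto_of_tendsto (tendsto_finsetSum s fun i _ => hX _ _) (hY x x) ?_
  filter_upwards [hX₀, hle] with a ha₀ ha
  calc _ ≤ ⟪x, φ (X a) x⟫_ℂ :=
        sum_le_hasSum s (fun i _ => loewner_nonneg_iff.1 ha₀ _) (h.hasSum (X a) x x)
    _ ≤ ⟪x, Y a x⟫_ℂ := loewner_le_iff.1 ha x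

variable {φ : (E →L[ℂ] E) →ₗ[ℂ] (E →L[ℂ] E)}

theorem le_map_of_tendsto (h : IsDeterminedBy φ A) {α : Type*} {f : Filter α} [f.NeBot]
    {X Y : α → E →L[ℂ] E} {X₀ Y₀ R : E →L[ℂ] E} (hXR : ∀ᶠ a in f, X a ≤ R)
    (hle : ∀ᶠ a in f, Y a ≤ φ (X a))
    (hX : Tendsto (fun a => ContinuousLinearMapWOT.ofCLM (X a)) f (𝓝 (.ofCLM X₀)))
    (hY : Tendsto (fun a => ContinuousLinearMapWOT.ofCLM (Y a)) f (𝓝 (.ofCLM Y₀))) :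
    Y₀ ≤ φ X₀ := by
  have hcompl : φ (R - X₀) ≤ φ R - Y₀ :=
    h.map_le_of_tendsto (X := fun a => R - X a) (Y := fun a => φ R - Y a)
      (hXR.mono fun _ => sub_nonneg.2)
      (hle.mono fun a ha => by rw [map_sub]; exact sub_le_sub_left ha _)
      (tendsto_const_nhds.sub hX) (tendsto_const_nhds.sub hY)
  rwa [map_sub, sub_le_sub_iff_left] at hcompl

theorem exists_mem_map_le (h : IsDeterminedBy φ A) {S : Set (E →L[ℂ] E)} {R : E →L[ℂ] E}
    (hSR : S ⊆ Set.Icc 0 R) (hS : Convex ℝ S)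
    (hclosed : IsClosed {B : E →WOT[ℂ] E | B.toCLM ∈ S}) (hne : S.Nonempty)
    (hstep : ∀ X ∈ S, ∃ Y ∈ S, φ X ≤ Y) : ∃ X ∈ S, φ X ≤ X := by
  choose! f hf hle using hstep
  obtain ⟨X, hX⟩ := hne
  obtain ⟨L, hL, hlim, hlim'⟩ := exists_mem_tendsto_birkhoffAverage hS hclosed
    (fun Y hY => CStarAlgebra.norm_le_norm_of_nonneg_of_le (hSR hY).1 (hSR hY).2) hf hX
  have hmem := (eventually_birkhoffAverage_mem hS hf hX).filter_mono Nat.hyperfilter_le_atTop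
  refine ⟨L, hL, h.map_le_of_tendsto (hmem.mono fun _ hn => (hSR hn).1)
    (.of_forall fun n => ?_) hlim hlim'⟩
  rw [map_birkhoffAverage ℝ ℝ φ]
  refine smul_le_smul_of_nonneg_left (Finset.sum_le_sum fun k _ => ?_) (by positivity)
  exact (hle _ (Set.MapsTo.iterate hf k hX)).trans_eq (Function.Commute.self_iterate f k X)

theorem exists_mem_map_eq (h : IsDeterminedBy φ A) {S : Set (E →L[ℂ] E)} {R : E →L[ℂ] E}
    (hSR : S ⊆ Set.Icc 0 R) (hS : Convex ℝ S)
    (hclosed : IsClosed {B : E →WOT[ℂ] E | B.toCLM ∈ S}) (hne : S.Nonempty)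
    (hmaps : Set.MapsTo φ S S) : ∃ X ∈ S, φ X = X := by
  obtain ⟨X, hX⟩ := hne
  obtain ⟨L, hL, hlim, hlim'⟩ := exists_mem_tendsto_birkhoffAverage hS hclosed
    (fun Y hY => CStarAlgebra.norm_le_norm_of_nonneg_of_le (hSR hY).1 (hSR hY).2) hmaps hX
  have hmem := (eventually_birkhoffAverage_mem hS hmaps hX).filter_mono Nat.hyperfilter_le_atTop
  have hmap (n : ℕ) : φ (birkhoffAverage ℝ φ id n X) = birkhoffAverage ℝ φ id n (φ X) := by
    rw [map_birkhoffAverage ℝ ℝ φ]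
    exact congr_arg _ (Finset.sum_congr rfl fun k _ => Function.Commute.self_iterate φ k X)
  refine ⟨L, hL, le_antisymm ?_ ?_⟩
  · exact h.map_le_of_tendsto (hmem.mono fun _ hn => (hSR hn).1)
      (.of_forall fun n => (hmap n).le) hlim hlim'
  · exact h.le_map_of_tendsto (hmem.mono fun _ hn => (hSR hn).2)
      (.of_forall fun n => (hmap n).ge) hlim hlim'

end IsDeterminedBy

theorem IsPureSolution.nonneg {E ι : Type*} [NormedAddCommGroup E] [InnerProductSpace ℂ E]
    [CompleteSpace E] {φ : (E →L[ℂ] E) → (E →L[ℂ] E)} {A : ι → (E →L[ℂ] E)} {C : E →L[ℂ] E}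
    (hC : IsPureSolution φ C) (hφ : IsDeterminedBy φ A) : 0 ≤ C := by
  refine loewner_nonneg_iff.2 fun x => ?_
  have hlim := (tendsto_const_nhds (x := x)).inner (𝕜 := ℂ) (hC.2 x)
  rw [inner_zero_right] at hlim
  exact le_of_tendsto' hlim fun k => loewner_le_iff.1
    (hφ.monotone.antitone_iterate_of_map_le hC.1 (Nat.zero_le k)) x

section StrongConvergence

theorem tendsto_apply_zero_of_tendsto_inner_self {α E : Type*} [NormedAddCommGroup E]
    [InnerProductSpace ℂ E] [CompleteSpace E] {f : Filter α} {A : α → E →L[ℂ] E} {N : ℝ}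
    (hA : ∀ a, 0 ≤ A a) (hN : ∀ a, ‖A a‖ ≤ N) {x : E}
    (h : Tendsto (fun a => ⟪x, A a x⟫_ℂ) f (𝓝 0)) : Tendsto (fun a => A a x) f (𝓝 0) := by
  have hsq : Tendsto (fun a => ‖A a x‖ ^ 2) f (𝓝 0) := by
    refine squeeze_zero (g := fun a => N * ‖⟪x, A a x⟫_ℂ‖) (fun _ => sq_nonneg _) (fun a => ?_)
      (by simpa using h.norm.const_mul N)
    exact (norm_apply_sq_le_of_nonneg (hA a) x).trans (by gcongr; exact hN a)
  exact tendsto_zero_iff_norm_tendsto_zero.2 (by simpa using hsq.sqrt)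

theorem tendsto_apply_zero_of_dense_span {α 𝕜 E F : Type*} [NontriviallyNormedField 𝕜]
    [SeminormedAddCommGroup E] [NormedSpace 𝕜 E] [SeminormedAddCommGroup F] [NormedSpace 𝕜 F]
    {f : Filter α} {A : α → E →L[𝕜] F} {N : ℝ} (hN : ∀ a, ‖A a‖ ≤ N) {S : Set E}
    (hS : (Submodule.span 𝕜 S).topologicalClosure = ⊤)
    (h : ∀ x ∈ S, Tendsto (fun a => A a x) f (𝓝 0)) (x : E) :
    Tendsto (fun a => A a x) f (𝓝 0) := by
  let M : Submodule 𝕜 E :=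
    { carrier := {x | Tendsto (fun a => A a x) f (𝓝 0)}
      zero_mem' := by simpa using tendsto_const_nhds
      add_mem' := fun hx hy => by simpa using Tendsto.add hx hy
      smul_mem' := fun c _ hx => by simpa using Tendsto.const_smul hx c }
  have hequi : Equicontinuous ((↑) ∘ A : α → E → F) :=
    (show (∃ N, ∀ a, ‖A a‖ ≤ N) ↔ _ from (NormedSpace.equicontinuous_TFAE A).out 5 1).1 ⟨N, hN⟩
  have hM : IsClosed (M : Set E) := hequi.isClosed_setOfPred_tendsto continuous_const
  have htop : ⊤ ≤ M := hS ▸ Submodule.topologicalClosure_minimal _ (Submodule.span_le.2 h) hM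
  exact htop trivial

end StrongConvergence

section Compression

variable {H K : Type*} [NormedAddCommGroup H] [InnerProductSpace ℂ H] [CompleteSpace H]
  [NormedAddCommGroup K] [InnerProductSpace ℂ K] [CompleteSpace K]
  {J : H →ₗᵢ[ℂ] K} {C : H →L[ℂ] H} {R : K →L[ℂ] K}

theorem inner_compression (D : K →L[ℂ] K) (x y : H) :
    ⟪x, compression J D y⟫_ℂ = ⟪J x, D (J y)⟫_ℂ := by
  simp [compression, ContinuousLinearMap.adjoint_inner_right]

theorem compression_mono : Monotone (compression J) := fun D D' h =>
  loewner_le_iff.2 fun x => by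
    simpa only [inner_compression] using loewner_le_iff.1 h (J x)

theorem norm_compression_le (D : K →L[ℂ] K) : ‖compression J D‖ ≤ ‖D‖ := by
  have hJ : ‖J.toContinuousLinearMap‖ ≤ 1 := J.norm_toContinuousLinearMap_le
  calc ‖compression J D‖
      ≤ ‖(J.toContinuousLinearMap)†‖ * (‖D‖ * ‖J.toContinuousLinearMap‖) :=
        (ContinuousLinearMap.opNorm_comp_le _ _).trans
          (mul_le_mul_of_nonneg_left (ContinuousLinearMap.opNorm_comp_le _ _) (norm_nonneg _))
    _ ≤ 1 * (‖D‖ * 1) := by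
        rw [LinearIsometryEquiv.norm_map]
        gcongr
    _ = ‖D‖ := by ring

theorem compression_algebraMap (N : ℝ) :
    compression J (algebraMap ℝ (K →L[ℂ] K) N) = algebraMap ℝ (H →L[ℂ] H) N := by
  ext y
  refine ext_inner_left ℂ fun x => ?_
  simp [inner_compression, Algebra.algebraMap_eq_smul_one, inner_smul_right_eq_smul]

theorem le_compression_algebraMap_norm (hC : 0 ≤ C) :
    C ≤ compression J (algebraMap ℝ (K →L[ℂ] K) ‖C‖) :=
  ((CStarAlgebra.norm_le_iff_le_algebraMap C (norm_nonneg C) hC).1 le_rfl).trans_eq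
    (compression_algebraMap ‖C‖).symm

/-- The positive dilations `D ≤ R` of `C`, the set in which solutions for `φ_V` are sought; the case
`R = ‖C‖` singles out the dilations of norm `‖C‖`. -/
def dilationsBelow (J : H →ₗᵢ[ℂ] K) (R : K →L[ℂ] K) (C : H →L[ℂ] H) : Set (K →L[ℂ] K) :=
  {D ∈ Set.Icc 0 R | compression J D = C}

theorem convex_dilationsBelow : Convex ℝ (dilationsBelow J R C) := by
  refine (convex_Icc 0 R).inter fun X hX Y hY a b _ _ hab => ?_
  calc compression J (a • X + b • Y) = a • compression J X + b • compression J Y := by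
        ext x
        simp [compression]
    _ = C := by rw [hX, hY, ← add_smul, hab, one_smul]

theorem isClosed_dilationsBelow :
    IsClosed {A : K →WOT[ℂ] K | A.toCLM ∈ dilationsBelow J R C} := by
  have hcompr (D : K →L[ℂ] K) :
      compression J D = C ↔ ∀ x y, ⟪J x, D (J y)⟫_ℂ = ⟪x, C y⟫_ℂ :=
    ⟨fun h x y => by rw [← inner_compression, h], fun h => by
      ext y
      exact ext_inner_left ℂ fun x => by rw [inner_compression, h]⟩
  refine (isClosed_setOf_toCLM_mem_Icc 0 R).inter (?_ : IsClosed {A : K →WOT[ℂ] K | _})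
  simp only [hcompr, ContinuousLinearMapWOT.toCLM_apply, Set.ofPred_forall]
  exact isClosed_iInter fun x => isClosed_iInter fun y =>
    isClosed_eq (by fun_prop) continuous_const

theorem exists_mem_dilationsBelow_ge {B : K →L[ℂ] K} (hB : 0 ≤ B) (hBR : B ≤ R)
    (hBC : compression J B ≤ C) (hCR : C ≤ compression J R) :
    ∃ D ∈ dilationsBelow J R C, B ≤ D := by
  obtain ⟨D, ⟨hBD, hDR⟩, hDC⟩ :=
    exists_mem_Icc_compression_eq J.toContinuousLinearMap hBR hBC hCR
  exact ⟨D, ⟨⟨hB.trans hBD, hDR⟩, hDC⟩, hBD⟩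

theorem dilationsBelow_nonempty (hC : 0 ≤ C) (hR : 0 ≤ R) (hCR : C ≤ compression J R) :
    (dilationsBelow J R C).Nonempty :=
  let ⟨D, hD, _⟩ := exists_mem_dilationsBelow_ge le_rfl hR (by simpa [compression] using hC) hCR
  ⟨D, hD⟩

theorem norm_eq_of_mem_dilationsBelow {D : K →L[ℂ] K}
    (hD : D ∈ dilationsBelow J (algebraMap ℝ (K →L[ℂ] K) ‖C‖) C) : ‖C‖ = ‖D‖ := by
  obtain ⟨⟨hD₀, hDC⟩, rfl⟩ := hD
  exact le_antisymm (norm_compression_le D)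
    ((CStarAlgebra.norm_le_iff_le_algebraMap D (norm_nonneg _) hD₀).2 hDC)

end Compression

namespace IsMinimalIsometricDilation

variable {H K ι : Type*} [NormedAddCommGroup H] [InnerProductSpace ℂ H] [CompleteSpace H]
  [NormedAddCommGroup K] [InnerProductSpace ℂ K] [CompleteSpace K]
  {T : ι → (H →L[ℂ] H)} {J : H →ₗᵢ[ℂ] K} {V : ι → (K →L[ℂ] K)}
  (hV : IsMinimalIsometricDilation T J V)
include hV

theorem adjoint_apply_self (i : ι) (x : K) : ((V i)†) (V i x) = x :=
  DFunLike.congr_fun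
    ((ContinuousLinearMap.norm_map_iff_adjoint_comp_self (V i)).1 (hV.norm_map i)) x

theorem adjoint_apply_of_ne {i j : ι} (hij : i ≠ j) (x : K) : ((V i)†) (V j x) = 0 := by
  refine ext_inner_left ℂ fun y => ?_
  rw [ContinuousLinearMap.adjoint_inner_right, hV.orthogonal_ranges i j hij, inner_zero_right]

section

variable {φV : (K →L[ℂ] K) → (K →L[ℂ] K)} (hφV : IsDeterminedBy φV V)
include hφV

theorem map_apply_apply (D : K →L[ℂ] K) (j : ι) (x : K) : φV D (V j x) = V j (D x) := by
  refine ext_inner_left ℂ fun y => (hφV.hasSum D y (V j x)).unique ?_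
  rw [← ContinuousLinearMap.adjoint_inner_left]
  convert hasSum_single j fun i hij => ?_ using 1
  · rw [hV.adjoint_apply_self]
  · rw [hV.adjoint_apply_of_ne hij, map_zero, inner_zero_right]

theorem iterate_map_word (D : K →L[ℂ] K) (α : List ι) (k : ℕ) (x : K) :
    φV^[k + α.length] D ((α.map V).prod x) = (α.map V).prod (φV^[k] D x) := by
  induction α with
  | nil => simp
  | cons j β ih =>
    rw [List.map_cons, List.prod_cons, mul_apply_eq_comp, mul_apply_eq_comp, List.length_cons,
      ← add_assoc, Function.iterate_succ_apply', hV.map_apply_apply hφV, ih]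

theorem map_one_le_one : φV 1 ≤ 1 := by
  have hsa : IsSelfAdjoint (φV 1) := (hφV.map_nonneg zero_le_one).isSelfAdjoint
  have hadj (i : ι) (y : K) : ((V i)†) (φV 1 y) = ((V i)†) y := by
    refine ext_inner_left ℂ fun z => ?_
    rw [ContinuousLinearMap.adjoint_inner_right, ← ContinuousLinearMap.adjoint_inner_left,
      hsa.adjoint_eq, hV.map_apply_apply hφV, ContinuousLinearMap.adjoint_inner_right,
      one_apply_eq_self]
  have hidem : IsIdempotentElem (φV 1) := by
    ext y
    refine ext_inner_left ℂ fun x => (hφV.hasSum 1 x (φV 1 y)).unique ?_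
    simp_rw [hadj]
    exact hφV.hasSum 1 x y
  exact (IsStarProjection.mk hidem hsa).le_one

variable {φT : (H →L[ℂ] H) → (H →L[ℂ] H)} (hT : IsDeterminedBy φT T)
include hT

theorem compression_map (D : K →L[ℂ] K) : compression J (φV D) = φT (compression J D) := by
  ext y
  refine ext_inner_left ℂ fun x => ?_
  rw [inner_compression]
  refine (hφV.hasSum D (J x) (J y)).unique ?_
  simp_rw [hV.adjoint_map, ← inner_compression]
  exact hT.hasSum _ x y

theorem compression_iterate (D : K →L[ℂ] K) (k : ℕ) :
    compression J (φV^[k] D) = φT^[k] (compression J D) :=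
  Function.Semiconj.iterate_right (hV.compression_map hφV hT) k D

theorem isPureSolution_of_compression {D : K →L[ℂ] K} (hD₀ : 0 ≤ D) (hD : φV D ≤ D)
    (hC : IsPureSolution φT (compression J D)) : IsPureSolution φV D := by
  have h₀ := hφV.iterate_nonneg hD₀
  have hN (k : ℕ) : ‖φV^[k] D‖ ≤ ‖D‖ :=
    CStarAlgebra.norm_le_norm_of_nonneg_of_le (h₀ k)
      (hφV.monotone.antitone_iterate_of_map_le hD (Nat.zero_le k))
  have hJ (x : H) : Tendsto (fun k => φV^[k] D (J x)) atTop (𝓝 0) := by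
    refine tendsto_apply_zero_of_tendsto_inner_self h₀ hN ?_
    simp_rw [← inner_compression, hV.compression_iterate hφV hT]
    simpa using (tendsto_const_nhds (x := x)).inner (𝕜 := ℂ) (hC.2 x)
  refine ⟨hD, tendsto_apply_zero_of_dense_span hN hV.minimal ?_⟩
  rintro _ ⟨α, x, rfl⟩
  rw [← tendsto_add_atTop_iff_nat α.length]
  simp_rw [hV.iterate_map_word hφV]
  simpa [Function.comp_def] using ((α.map V).prod.continuous.tendsto 0).comp (hJ x)

theorem isPureSolution_compression {D : K →L[ℂ] K} (hD : IsPureSolution φV D) :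
    IsPureSolution φT (compression J D) := by
  refine ⟨hV.compression_map hφV hT D ▸ compression_mono hD.1, fun x => ?_⟩
  simp_rw [← hV.compression_iterate hφV hT]
  simpa [compression, Function.comp_def] using
    (((J.toContinuousLinearMap)†).continuous.tendsto 0).comp (hD.2 (J x))

end

variable {φT : (H →L[ℂ] H) → (H →L[ℂ] H)} {φV : (K →L[ℂ] K) →ₗ[ℂ] (K →L[ℂ] K)}
  (hφV : IsDeterminedBy φV V) {C : H →L[ℂ] H}
include hφV

theorem map_algebraMap_le {N : ℝ} (hN : 0 ≤ N) :
    φV (algebraMap ℝ (K →L[ℂ] K) N) ≤ algebraMap ℝ (K →L[ℂ] K) N := by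
  rw [Algebra.algebraMap_eq_smul_one, LinearMap.map_smul_of_tower]
  exact smul_le_smul_of_nonneg_left (hV.map_one_le_one hφV) hN

variable (hT : IsDeterminedBy φT T) (hC : 0 ≤ C)
include hT hC

theorem exists_mem_dilationsBelow_map_le {R : K →L[ℂ] K} (hR : 0 ≤ R) (hφR : φV R ≤ R)
    (hCR : C ≤ compression J R) (hφC : φT C ≤ C) : ∃ D ∈ dilationsBelow J R C, φV D ≤ D := by
  refine hφV.exists_mem_map_le (fun _ hD => hD.1) convex_dilationsBelow isClosed_dilationsBelow
    (dilationsBelow_nonempty hC hR hCR) ?_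
  rintro X ⟨⟨hX, hXR⟩, rfl⟩
  exact exists_mem_dilationsBelow_ge (hφV.map_nonneg hX) ((hφV.monotone hXR).trans hφR)
    ((hV.compression_map hφV hT X).trans_le hφC) hCR

theorem exists_mem_dilationsBelow_map_eq {R : K →L[ℂ] K} (hR : 0 ≤ R) (hφR : φV R ≤ R)
    (hCR : C ≤ compression J R) (hφC : φT C = C) : ∃ D ∈ dilationsBelow J R C, φV D = D := by
  refine hφV.exists_mem_map_eq (fun _ hD => hD.1) convex_dilationsBelow isClosed_dilationsBelow
    (dilationsBelow_nonempty hC hR hCR) ?_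
  rintro X ⟨⟨hX, hXR⟩, rfl⟩
  exact ⟨⟨hφV.map_nonneg hX, (hφV.monotone hXR).trans hφR⟩,
    (hV.compression_map hφV hT X).trans hφC⟩

theorem exists_map_le_compression_eq (hφC : φT C ≤ C) :
    ∃ D, 0 ≤ D ∧ φV D ≤ D ∧ C = compression J D ∧ ‖C‖ = ‖D‖ :=
  let ⟨D, hD, hφD⟩ := hV.exists_mem_dilationsBelow_map_le hφV hT hC
    (algebraMap_nonneg _ (norm_nonneg C)) (hV.map_algebraMap_le hφV (norm_nonneg C))
    (le_compression_algebraMap_norm hC) hφC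
  ⟨D, hD.1.1, hφD, hD.2.symm, norm_eq_of_mem_dilationsBelow hD⟩

theorem exists_map_eq_compression_eq (hφC : φT C = C) :
    ∃ D, 0 ≤ D ∧ φV D = D ∧ C = compression J D ∧ ‖C‖ = ‖D‖ :=
  let ⟨D, hD, hφD⟩ := hV.exists_mem_dilationsBelow_map_eq hφV hT hC
    (algebraMap_nonneg _ (norm_nonneg C)) (hV.map_algebraMap_le hφV (norm_nonneg C))
    (le_compression_algebraMap_norm hC) hφC
  ⟨D, hD.1.1, hφD, hD.2.symm, norm_eq_of_mem_dilationsBelow hD⟩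

end IsMinimalIsometricDilation

theorem theorem3p5_general {H K ι : Type*}
    [NormedAddCommGroup H] [InnerProductSpace ℂ H] [CompleteSpace H]
    [NormedAddCommGroup K] [InnerProductSpace ℂ K] [CompleteSpace K]
    (φT : (H →L[ℂ] H) → (H →L[ℂ] H)) (T : ι → (H →L[ℂ] H)) (hT : IsDeterminedBy φT T)
    (J : H →ₗᵢ[ℂ] K) (V : ι → (K →L[ℂ] K)) (hV : IsMinimalIsometricDilation T J V)
    (φV : (K →L[ℂ] K) →ₗ[ℂ] (K →L[ℂ] K)) (hφV : IsDeterminedBy φV V) :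
    (∀ C : H →L[ℂ] H, 0 ≤ C →
      (φT C ≤ C ↔
        ∃ D : K →L[ℂ] K, 0 ≤ D ∧ φV D ≤ D ∧ C = compression J D ∧ ‖C‖ = ‖D‖) ∧
      (φT C = C ↔
        ∃ D : K →L[ℂ] K, 0 ≤ D ∧ φV D = D ∧ C = compression J D ∧ ‖C‖ = ‖D‖)) ∧
    (∀ C : H →L[ℂ] H,
      IsPureSolution φT C ↔
        ∃ D : K →L[ℂ] K, IsPureSolution φV D ∧ C = compression J D ∧ ‖C‖ = ‖D‖) := by
  have hmap := hV.compression_map hφV hT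
  refine ⟨fun C hC => ⟨⟨hV.exists_map_le_compression_eq hφV hT hC, ?_⟩,
    ⟨hV.exists_map_eq_compression_eq hφV hT hC, ?_⟩⟩, fun C => ⟨fun hC => ?_, ?_⟩⟩
  · rintro ⟨D, -, hD, rfl, -⟩
    exact hmap D ▸ compression_mono hD
  · rintro ⟨D, -, hD, rfl, -⟩
    rw [← hmap, hD]
  · obtain ⟨D, hD₀, hD, rfl, hnorm⟩ :=
      hV.exists_map_le_compression_eq hφV hT (hC.nonneg hT) hC.1
    exact ⟨D, hV.isPureSolution_of_compression hφV hT hD₀ hD hC, rfl, hnorm⟩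
  · rintro ⟨D, hD, rfl, -⟩
    exact hV.isPureSolution_compression hφV hT hD

/-- The family `T` (finite or infinite) determines the `w*`-continuous completely positive map
`φT`, and `φV` is the map determined by the minimal isometric dilation `V` of `T`. -/
theorem theorem3p5 {H K ι : Type*}
    [NormedAddCommGroup H] [InnerProductSpace ℂ H] [CompleteSpace H]
    [TopologicalSpace.SeparableSpace H]
    [NormedAddCommGroup K] [InnerProductSpace ℂ K] [CompleteSpace K]
    [Countable ι]
    (φT : (H →L[ℂ] H) →CP (H →L[ℂ] H)) (hφT : IsWeakStarContinuous φT)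
    (T : ι → (H →L[ℂ] H)) (hT : IsDeterminedBy φT T) (hφT_one : φT 1 ≤ 1)
    (J : H →ₗᵢ[ℂ] K) (V : ι → (K →L[ℂ] K)) (hV : IsMinimalIsometricDilation T J V)
    (φV : (K →L[ℂ] K) →ₗ[ℂ] (K →L[ℂ] K)) (hφV : IsDeterminedBy φV V) :
    (∀ C : H →L[ℂ] H, 0 ≤ C →
      (φT C ≤ C ↔
        ∃ D : K →L[ℂ] K, 0 ≤ D ∧ φV D ≤ D ∧ C = compression J D ∧ ‖C‖ = ‖D‖) ∧
      (φT C = C ↔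
        ∃ D : K →L[ℂ] K, 0 ≤ D ∧ φV D = D ∧ C = compression J D ∧ ‖C‖ = ‖D‖)) ∧
    (∀ C : H →L[ℂ] H,
      IsPureSolution φT C ↔
        ∃ D : K →L[ℂ] K, IsPureSolution φV D ∧ C = compression J D ∧ ‖C‖ = ‖D‖) :=
  theorem3p5_general φT T hT J V hV φV hφV
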